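/- Let $C(t)=\sum_{k=1}^N |a_k|^2 e^{i\omega_k t}$ be a signal with pairwise distinct real frequencies $\omega_k$ and $a_k\neq 0$. Let $T,W>0$, let $\omega^*\in\mathbb R$, and let $(f_l)_{l\ge1}$ be a $WT$-filter system: the $f_l\in L^2(\mathbb R)$ vanish outside $[-T,T]$, and their Fourier transforms $F_l(\omega)=\int f_l(t)e^{-i\omega t}\,dt$ form a complete Chebyshev system on $[-W,W]$, i.e. $\det(F_j(w_i))_{i,j\le n}\neq0$ for every $n$ and all distinct $w_1,\dots,w_n\in[-W,W]$. Put $\mathfrak F^{\mathrm{env}}_M(\omega)=\sum_{l=1}^M|F_l(\omega)|^2$ and let $\omega_1>\dots>\omega_m$ be the frequencies of $C$ in $B=[\omega^*-W,\omega^*+W]$. For $M\ge m$, Filter Diagonalization forms the $M\times M$ matrices $$(V_M^2)_{sl}=\int_{-T}^{T}\!\int_{-T}^{T}e^{-i\omega^*(\tau-t)}\overline{f_s(\tau)}f_l(t)\,C(\tau-t)\,dt\,d\tau,$$ $$(H_{V_M})_{sl}=i\int_{-T}^{T}\!\int_{-T}^{T}e^{-i\omega^*(\tau-t)}\overline{f_s(\tau)}f_l(t)\,\partial_tC(\tau-t)\,dt\,d\tau,$$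 takes a matrix $U_m$ whose columns are orthonormal eigenvectors of $V_M^2$ for its $m$ largest eigenvalues, and returns the $m$ generalized eigenvalues $\tilde\omega_1\ge\dots\ge\tilde\omega_m$ of $U_m^\dagger H_{V_M}U_m\Phi=U_m^\dagger V_M^2U_m\Phi\,\mathrm{diag}(\tilde\omega)$ ($\Phi$ invertible). Let $$(N_M^2)_{sl}=\sum_{\omega_k\notin B}|a_k|^2\,\overline{F_s(\omega_k-\omega^*)}\,F_l(\omega_k-\omega^*)$$ be the noise Gram matrix (the sum runs over the frequencies of $C$ outside $B$), and let $\lambda_1(\cdot)\ge\lambda_2(\cdot)\ge\cdots$ be the eigenvalues of a Hermitian matrix in descending order. Then for all $k\in\{1,\dots,m\}$: 1. If all frequencies of $C$ lie in $[\omega_{\min},\omega_{\max}]$, then $$\frac{\lambda_1(N_M^2)}{\lambda_m(V_M^2)}(\omega_{\min}-\omega_k)\le\tilde\omega_k-\omega_k\le\frac{\lambda_1(N_M^2)}{\lambda_m(V_M^2)}(\omega_{\max}-\omega_k).$$ 2. If $\lambda_m(V_M^2)>(m+1)\lambda_1(N_M^2)$, then $$\frac{\sum_{\omega_l<\omega^*-W}(\omega_l-\omega_k)|a_l|^2\,\mathfrak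 F^{\mathrm{env}}_M(\omega_l-\omega^*)}{\lambda_m(V_M^2)-\lambda_1(N_M^2)}\le\tilde\omega_k-\omega_k\le\frac{\sum_{\omega_l>\omega^*+W}(\omega_l-\omega_k)|a_l|^2\,\mathfrak F^{\mathrm{env}}_M(\omega_l-\omega^*)}{\lambda_m(V_M^2)-\lambda_1(N_M^2)},$$ where the sums run over the frequencies $\omega_l$ of $C$ below and above the band, respectively. -/

import Mathlib

open MeasureTheory

noncomputable section

namespace FilterDiag

/-- A signal `C(t) = ∑ₖ |aₖ|² exp(i ωₖ t)` with finitely many pairwise distinct real frequencies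
`ωₖ`, each of which really occurs in the signal (`aₖ ≠ 0`). -/
structure Signal where
  /-- the number of frequencies -/
  N : ℕ
  /-- the frequencies `ωₖ` -/
  freq : Fin N → ℝ
  /-- the coefficients `aₖ` -/
  amp : Fin N → ℂ
  freq_injective : Function.Injective freq
  amp_ne_zero : ∀ k, amp k ≠ 0

/-- The value `C(t)` of the signal at time `t`. -/
def Signal.C (S : Signal) (t : ℝ) : ℂ :=
  ∑ k, ((‖S.amp k‖ ^ 2 : ℝ) : ℂ) * Complex.exp (Complex.I * (S.freq k : ℂ) * (t : ℂ))

/-- The Fourier transform `∫ f(t) exp(-iωt) dt` in the angular frequency convention. -/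
def fourierTransform (f : ℝ → ℂ) (ω : ℝ) : ℂ :=
  ∫ t : ℝ, f t * Complex.exp (-Complex.I * (ω : ℂ) * (t : ℂ))

/-- `F₀, F₁, …` is a complete Chebyshev system on `[-W, W]`: for every `n` and all pairwise distinct
points `w₁, …, wₙ` of `[-W, W]`, the alternant matrix of the first `n` functions is nonsingular. -/
def IsCompleteChebyshevSystem (W : ℝ) (F : ℕ → ℝ → ℂ) : Prop :=
  ∀ (n : ℕ) (w : Fin n → ℝ), Function.Injective w → (∀ i, w i ∈ Set.Icc (-W) W) →
    (Matrix.of fun i j : Fin n => F (j : ℕ) (w i)).det ≠ 0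

/-- A `W T`-filter system: square integrable functions `fₗ` that vanish (almost everywhere) outside
`[-T, T]`, whose Fourier transforms `Fₗ` form a complete Chebyshev system on `[-W, W]`. The
functions are numbered from `0`. -/
structure FilterSystem (T W : ℝ) where
  /-- the time duals `fₗ` -/
  f : ℕ → ℝ → ℂ
  memLp : ∀ l, MemLp (f l) 2 volume
  support : ∀ l, ∀ᵐ t : ℝ, t ∉ Set.Icc (-T) T → f l t = 0
  chebyshev : IsCompleteChebyshevSystem W fun l => fourierTransform (f l)

variable {T W : ℝ}

/-- The filter functions `Fₗ` in frequency space. -/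
def FilterSystem.F (Fs : FilterSystem T W) (l : ℕ) (ω : ℝ) : ℂ :=
  fourierTransform (Fs.f l) ω

/-- The filter envelope of degree `M`. -/
def FilterSystem.envelope (Fs : FilterSystem T W) (M : ℕ) (ω : ℝ) : ℝ :=
  ∑ l : Fin M, ‖Fs.F l ω‖ ^ 2

/-- The band `[ω⋆ - W, ω⋆ + W]`. -/
def band (W ωc : ℝ) : Set ℝ := Set.Icc (ωc - W) (ωc + W)

/-- The Gram matrix `V²` with filter centre `ωc`, computed from the signal in the time domain. -/
def gramMatrix (S : Signal) (Fs : FilterSystem T W) (ωc : ℝ) (M : ℕ) :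
    Matrix (Fin M) (Fin M) ℂ :=
  Matrix.of fun s l => ∫ τ in (-T)..T, ∫ t in (-T)..T,
    Complex.exp (-Complex.I * (ωc : ℂ) * ((τ : ℂ) - (t : ℂ))) *
      (starRingEnd ℂ) (Fs.f s τ) * Fs.f l t * S.C (τ - t)

/-- The projected operator `H_V` with filter centre `ωc`, computed from the signal in the time
domain. -/
def hamiltonianMatrix (S : Signal) (Fs : FilterSystem T W) (ωc : ℝ) (M : ℕ) :
    Matrix (Fin M) (Fin M) ℂ :=
  Matrix.of fun s l => Complex.I * ∫ τ in (-T)..T, ∫ t in (-T)..T,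
    Complex.exp (-Complex.I * (ωc : ℂ) * ((τ : ℂ) - (t : ℂ))) *
      (starRingEnd ℂ) (Fs.f s τ) * Fs.f l t * deriv (fun t' : ℝ => S.C (τ - t')) t

open Classical in
/-- The noise Gram matrix `N²`: the contribution to `V²` of the frequencies outside the band. -/
def noiseGramMatrix (S : Signal) (Fs : FilterSystem T W) (ωc : ℝ) (M : ℕ) :
    Matrix (Fin M) (Fin M) ℂ :=
  Matrix.of fun s l => ∑ k with S.freq k ∉ band W ωc,
    ((‖S.amp k‖ ^ 2 : ℝ) : ℂ) * (starRingEnd ℂ) (Fs.F s (S.freq k - ωc)) *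
      Fs.F l (S.freq k - ωc)

/-- The `j`-th largest eigenvalue `λⱼ(A)` of a Hermitian `M × M` matrix, counted with multiplicity,
for `1 ≤ j ≤ M` (and `0` for other `j`). -/
def eigenvalueDesc {M : ℕ} {A : Matrix (Fin M) (Fin M) ℂ} (hA : A.IsHermitian) (j : ℕ) : ℝ :=
  if h : 1 ≤ j ∧ j ≤ M then
    hA.eigenvalues₀ ⟨j - 1, by rw [Fintype.card_fin]; omega⟩
  else 0

/-- `ωt` is a list of frequencies returned by Filter Diagonalization for the pair `(H, V2)`, the
number `m` of wanted frequencies and the guess dimension `M ≥ m`: diagonalize `V2` by a unitary `U`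
with eigenvalues in descending order, keep the leading `m` columns `Uₘ` of `U`, and solve the
generalized eigenvalue problem `Uₘᴴ H Uₘ Φ = Uₘᴴ V2 Uₘ Φ Λ(ωt)`, with `Φ` a basis of generalized
eigenvectors. The returned frequencies are listed in descending order. -/
def IsOutput {M m : ℕ} (hmM : m ≤ M) (H V2 : Matrix (Fin M) (Fin M) ℂ) (ωt : Fin m → ℝ) : Prop :=
  Antitone ωt ∧
  ∃ U ∈ Matrix.unitaryGroup (Fin M) ℂ, ∃ lam : Fin M → ℝ, Antitone lam ∧
    U.conjTranspose * V2 * U = Matrix.diagonal (fun i => (lam i : ℂ)) ∧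
    ∃ Φ : Matrix (Fin m) (Fin m) ℂ, IsUnit Φ ∧
      let Um : Matrix (Fin M) (Fin m) ℂ := U.submatrix id (Fin.castLE hmM)
      (Um.conjTranspose * H * Um) * Φ =
        (Um.conjTranspose * V2 * Um) * Φ * Matrix.diagonal (fun i => (ωt i : ℂ))

/-- `ν₁ > ⋯ > νₘ` are exactly the frequencies of the signal in the band `[ωc - W, ωc + W]`. -/
def IsBandFrequencies (S : Signal) (W ωc : ℝ) {m : ℕ} (ν : Fin m → ℝ) : Prop :=
  StrictAnti ν ∧ Set.range ν = Set.range S.freq ∩ band W ωc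

theorem noiseGramMatrix_isHermitian (S : Signal) (Fs : FilterSystem T W) (ωc : ℝ) (M : ℕ) :
    (noiseGramMatrix S Fs ωc M).IsHermitian := by
  ext s l
  simp only [noiseGramMatrix, Matrix.conjTranspose_apply, Matrix.of_apply, star_sum]
  refine Finset.sum_congr rfl fun k _ => ?_
  simp only [RCLike.star_def, map_mul, Complex.conj_ofReal, Complex.conj_conj]
  ring

/-- The frequency representation of the time domain double integrals. -/
theorem integral_gram (f g : ℝ → ℂ) (hf : IntervalIntegrable f volume (-T) T)
    (hg : IntervalIntegrable g volume (-T) T) (ωc : ℝ) {n : ℕ} (c : Fin n → ℂ) (w : Fin n → ℝ) :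
    (∫ τ in (-T)..T, ∫ t in (-T)..T,
      Complex.exp (-Complex.I * (ωc : ℂ) * ((τ : ℂ) - (t : ℂ))) * (starRingEnd ℂ) (f τ) * g t *
        ∑ k, c k * Complex.exp (Complex.I * (w k : ℂ) * ((τ - t : ℝ) : ℂ))) =
    ∑ k, c k *
      (starRingEnd ℂ) (∫ τ in (-T)..T,
        f τ * Complex.exp (-Complex.I * ((w k - ωc : ℝ) : ℂ) * (τ : ℂ))) *
      ∫ t in (-T)..T, g t * Complex.exp (-Complex.I * ((w k - ωc : ℝ) : ℂ) * (t : ℂ)) := by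
  have key : ∀ τ t : ℝ,
      Complex.exp (-Complex.I * (ωc : ℂ) * ((τ : ℂ) - (t : ℂ))) * (starRingEnd ℂ) (f τ) * g t *
        ∑ k, c k * Complex.exp (Complex.I * (w k : ℂ) * ((τ - t : ℝ) : ℂ)) =
      ∑ k, (c k * (starRingEnd ℂ)
          (f τ * Complex.exp (-Complex.I * ((w k - ωc : ℝ) : ℂ) * (τ : ℂ)))) *
        (g t * Complex.exp (-Complex.I * ((w k - ωc : ℝ) : ℂ) * (t : ℂ))) := by
    intro τ t
    rw [Finset.mul_sum]
    refine Finset.sum_congr rfl fun k _ => ?_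
    rw [map_mul, ← Complex.exp_conj]
    simp only [map_mul, map_neg, Complex.conj_I, Complex.conj_ofReal, neg_neg]
    have : Complex.exp (-Complex.I * (ωc : ℂ) * ((τ : ℂ) - (t : ℂ))) *
        Complex.exp (Complex.I * (w k : ℂ) * ((τ - t : ℝ) : ℂ)) =
        Complex.exp (Complex.I * ((w k - ωc : ℝ) : ℂ) * (τ : ℂ)) *
        Complex.exp (-Complex.I * ((w k - ωc : ℝ) : ℂ) * (t : ℂ)) := by
      rw [← Complex.exp_add, ← Complex.exp_add]
      congr 1
      push_cast
      ring
    linear_combination (starRingEnd ℂ) (f τ) * g t * c k * this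
  have hint : ∀ (h : ℝ → ℂ) (_ : IntervalIntegrable h volume (-T) T) (v : ℝ),
      IntervalIntegrable (fun t => h t * Complex.exp (-Complex.I * (v : ℂ) * (t : ℂ)))
        volume (-T) T := fun h hh v =>
    hh.mul_continuousOn (by fun_prop)
  simp only [key]
  have inner : ∀ τ : ℝ, (∫ t in (-T)..T, ∑ k, (c k * (starRingEnd ℂ)
          (f τ * Complex.exp (-Complex.I * ((w k - ωc : ℝ) : ℂ) * (τ : ℂ)))) *
        (g t * Complex.exp (-Complex.I * ((w k - ωc : ℝ) : ℂ) * (t : ℂ)))) =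
      ∑ k, (c k * ∫ t in (-T)..T,
          g t * Complex.exp (-Complex.I * ((w k - ωc : ℝ) : ℂ) * (t : ℂ))) *
        (starRingEnd ℂ) (f τ * Complex.exp (-Complex.I * ((w k - ωc : ℝ) : ℂ) * (τ : ℂ))) := by
    intro τ
    rw [intervalIntegral.integral_finsetSum fun k _ => (hint g hg _).const_mul _]
    refine Finset.sum_congr rfl fun k _ => ?_
    rw [intervalIntegral.integral_const_mul]
    ring
  simp only [inner]
  have hconj : ∀ k, IntervalIntegrable (fun τ : ℝ => (starRingEnd ℂ)
      (f τ * Complex.exp (-Complex.I * ((w k - ωc : ℝ) : ℂ) * (τ : ℂ)))) volume (-T) T :=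
    fun k => ⟨Complex.conjCLE.toContinuousLinearMap.integrable_comp (hint f hf _).1,
      Complex.conjCLE.toContinuousLinearMap.integrable_comp (hint f hf _).2⟩
  rw [intervalIntegral.integral_finsetSum fun k _ => (hconj k).const_mul _]
  refine Finset.sum_congr rfl fun k _ => ?_
  rw [intervalIntegral.integral_const_mul]
  have : (∫ τ in (-T)..T, (starRingEnd ℂ)
      (f τ * Complex.exp (-Complex.I * ((w k - ωc : ℝ) : ℂ) * (τ : ℂ)))) =
      (starRingEnd ℂ) (∫ τ in (-T)..T,
        f τ * Complex.exp (-Complex.I * ((w k - ωc : ℝ) : ℂ) * (τ : ℂ))) := by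
    simp only [intervalIntegral, integral_conj, map_sub]
  rw [this]
  ring

theorem FilterSystem.intervalIntegrable (Fs : FilterSystem T W) (l : ℕ) :
    IntervalIntegrable (Fs.f l) volume (-T) T := by
  rw [intervalIntegrable_iff]
  haveI : IsFiniteMeasure (volume.restrict (Set.uIoc (-T) T)) :=
    ⟨by rw [Measure.restrict_apply_univ, Set.uIoc]; exact measure_Ioc_lt_top⟩
  exact ((Fs.memLp l).restrict _).integrable (by norm_num)

theorem gramMatrix_isHermitian (S : Signal) (Fs : FilterSystem T W) (ωc : ℝ) (M : ℕ) :
    (gramMatrix S Fs ωc M).IsHermitian := by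
  ext s l
  simp only [gramMatrix, Matrix.conjTranspose_apply, Matrix.of_apply, Signal.C]
  rw [integral_gram _ _ (Fs.intervalIntegrable _) (Fs.intervalIntegrable _),
    integral_gram _ _ (Fs.intervalIntegrable _) (Fs.intervalIntegrable _), star_sum]
  refine Finset.sum_congr rfl fun k _ => ?_
  simp only [RCLike.star_def, map_mul, Complex.conj_ofReal, Complex.conj_conj]
  ring

/-- The `j`-th largest eigenvalue `λⱼ(V²)` of the Gram matrix. -/
def gramEigenvalue (S : Signal) (Fs : FilterSystem T W) (ωc : ℝ) (M j : ℕ) : ℝ :=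
  eigenvalueDesc (gramMatrix_isHermitian S Fs ωc M) j

/-- The `j`-th largest eigenvalue `λⱼ(N²)` of the noise Gram matrix. -/
def noiseEigenvalue (S : Signal) (Fs : FilterSystem T W) (ωc : ℝ) (M j : ℕ) : ℝ :=
  eigenvalueDesc (noiseGramMatrix_isHermitian S Fs ωc M) j

end FilterDiag

end

/-!
The Gram matrix, the projected operator and the noise Gram matrix all have the form `Fᴴ diag(w) F`,
where the rows of `F` are the filter values at the frequencies of the signal and the weights `w` are
`|aₖ|²`, `ωₖ |aₖ|²` and, outside the band, again `|aₖ|²`. To bound `ω̃ₖ` from above, combine the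
Ritz vectors of `ω̃₁, …, ω̃ₖ` to a nonzero vector `y` annihilated by the `k - 1` rows of `F` that
belong to `ω₁, …, ωₖ₋₁`. In the quadratic form of `H - ωₖ V²` at `y` the band then contributes
nothing positive. As `V²` is at least `λₘ(V²)` on the Ritz vectors, `(ω̃ₖ - ωₖ) λₘ(V²)` is at most
the largest contribution of the frequencies outside the band to this form on unit vectors. This is
estimated by `λ₁(N²)` or, by Cauchy–Schwarz, by the filter envelope. The lower bounds follow by
negating all frequencies.
-/

namespace FilterDiag

open Matrix
open scoped ComplexOrder MatrixOrder

variable {𝕜 ι n p : Type*} [RCLike 𝕜]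

section QuadraticForms

variable [Fintype n] [Fintype p]

theorem star_dotProduct_self_eq_sum (y : n → 𝕜) :
    star y ⬝ᵥ y = ((∑ i, ‖y i‖ ^ 2 : ℝ) : 𝕜) := by
  simp [dotProduct, RCLike.conj_mul]

theorem star_mulVec_dotProduct_mulVec (B : Matrix n p 𝕜) (A : Matrix n n 𝕜) (x : p → 𝕜) :
    star (B *ᵥ x) ⬝ᵥ (A *ᵥ (B *ᵥ x)) = star x ⬝ᵥ ((Bᴴ * A * B) *ᵥ x) := by
  rw [star_mulVec, ← dotProduct_mulVec, mulVec_mulVec, mulVec_mulVec, Matrix.mul_assoc]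

theorem star_dotProduct_mulVec_le_of_le {A B : Matrix n n 𝕜} (h : A ≤ B) (x : n → 𝕜) :
    star x ⬝ᵥ (A *ᵥ x) ≤ star x ⬝ᵥ (B *ᵥ x) := by
  have := (Matrix.le_iff.1 h).dotProduct_mulVec_nonneg x
  rwa [sub_mulVec, dotProduct_sub, sub_nonneg] at this

theorem norm_dotProduct_sq_le (u y : n → 𝕜) :
    ‖u ⬝ᵥ y‖ ^ 2 ≤ (∑ i, ‖u i‖ ^ 2) * ∑ i, ‖y i‖ ^ 2 :=
  calc ‖u ⬝ᵥ y‖ ^ 2 ≤ (∑ i, ‖u i‖ * ‖y i‖) ^ 2 := by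
        gcongr
        exact norm_sum_le_of_le _ fun i _ => norm_mul_le _ _
    _ ≤ _ := Finset.sum_mul_sq_le_sq_mul_sq _ _ _

theorem le_smul_one_of_eigenvalues_le [DecidableEq n] {A : Matrix n n 𝕜} (hA : A.IsHermitian)
    {r : ℝ} (h : ∀ i, hA.eigenvalues i ≤ r) : A ≤ r • 1 := by
  rw [← Algebra.algebraMap_eq_smul_one]
  refine le_algebraMap_of_spectrum_le ?_ hA
  rw [hA.spectrum_real_eq_range_eigenvalues]
  exact Set.forall_mem_range.2 h

theorem eigenvalues₀_pos_of_lt_rank [DecidableEq n] {A : Matrix n n 𝕜} (hA : A.PosSemidef)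
    {i : Fin (Fintype.card n)} (hi : (i : ℕ) < A.rank) : 0 < hA.1.eigenvalues₀ i := by
  by_contra! h
  have hcard := hA.1.rank_eq_card_non_zero_eigs
  let e : Fin (Fintype.card n) ≃ n := Fintype.equivOfCardEq (Fintype.card_fin _)
  have hzero : ∀ j, hA.1.eigenvalues j ≠ 0 → e.symm j < i := fun j hj => by
    by_contra! hij
    exact hj (((hA.1.eigenvalues₀_antitone hij).trans h).antisymm (hA.eigenvalues_nonneg j))
  have hle : Fintype.card {j // hA.1.eigenvalues j ≠ 0} ≤ Fintype.card (Finset.Iio i) :=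
    Fintype.card_le_of_injective (fun j => ⟨e.symm j, Finset.mem_Iio.2 (hzero j j.2)⟩)
      fun j j' h => Subtype.ext (e.symm.injective (congrArg Subtype.val h))
  rw [Fintype.card_coe, Fin.card_Iio] at hle
  omega

end QuadraticForms

section WeightedGram

variable [Fintype ι] [DecidableEq ι]

/-- The matrix `Fᴴ diag(w) F`, that is, the weighted sum `∑ₗ wₗ Fₗᴴ Fₗ` over the rows `Fₗ` of `F`.
For the filter values at the frequencies of a signal, the Gram matrix, the projected operator and
the noise Gram matrix differ only in the weights. -/
def weightedGram (F : Matrix ι n 𝕜) (w : ι → ℝ) : Matrix n n 𝕜 :=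
  Fᴴ * diagonal (fun l => (w l : 𝕜)) * F

variable (F : Matrix ι n 𝕜)

theorem weightedGram_apply (w : ι → ℝ) (i j : n) :
    weightedGram F w i j = ∑ l, (w l : 𝕜) * star (F l i) * F l j := by
  rw [weightedGram, mul_apply]
  simp only [mul_diagonal, conjTranspose_apply]
  exact Finset.sum_congr rfl fun l _ => by ring

theorem weightedGram_isHermitian (w : ι → ℝ) : (weightedGram F w).IsHermitian :=
  isHermitian_conjTranspose_mul_mul F <| isHermitian_diagonal_of_self_adjoint _ <|
    funext fun l => RCLike.conj_ofReal (w l)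

theorem weightedGram_sub (v w : ι → ℝ) :
    weightedGram F (v - w) = weightedGram F v - weightedGram F w := by
  simp [weightedGram, ← diagonal_sub, Matrix.mul_sub, Matrix.sub_mul]

theorem weightedGram_neg (w : ι → ℝ) : weightedGram F (-w) = -weightedGram F w := by
  simp [weightedGram, ← diagonal_neg]

theorem weightedGram_smul (r : ℝ) (w : ι → ℝ) :
    weightedGram F (r • w) = r • weightedGram F w := by
  ext i j
  simp [weightedGram_apply, Finset.mul_sum, mul_assoc, RCLike.real_smul_eq_coe_mul]

theorem weightedGram_posSemidef [Finite n] {w : ι → ℝ} (hw : 0 ≤ w) :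
    (weightedGram F w).PosSemidef :=
  (PosSemidef.diagonal fun l => RCLike.ofReal_nonneg.2 (hw l)).conjTranspose_mul_mul_same F

theorem weightedGram_mono [Finite n] : Monotone (weightedGram F) := fun v w hvw => by
  rw [Matrix.le_iff, ← weightedGram_sub]
  exact weightedGram_posSemidef F (sub_nonneg.2 hvw)

variable [Fintype n]

theorem star_dotProduct_weightedGram_mulVec (w : ι → ℝ) (y : n → 𝕜) :
    star y ⬝ᵥ (weightedGram F w *ᵥ y) = ((∑ l, w l * ‖(F *ᵥ y) l‖ ^ 2 : ℝ) : 𝕜) := by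
  rw [weightedGram, ← star_mulVec_dotProduct_mulVec]
  simp only [dotProduct, mulVec_diagonal, Pi.star_apply, RCLike.star_def, RCLike.ofReal_sum]
  refine Finset.sum_congr rfl fun l _ => ?_
  push_cast
  rw [← RCLike.conj_mul]
  ring

theorem star_dotProduct_weightedGram_mulVec_le {v w : ι → ℝ} {y : n → 𝕜}
    (h : ∀ l, (F *ᵥ y) l ≠ 0 → v l ≤ w l) :
    star y ⬝ᵥ (weightedGram F v *ᵥ y) ≤ star y ⬝ᵥ (weightedGram F w *ᵥ y) := by
  rw [star_dotProduct_weightedGram_mulVec, star_dotProduct_weightedGram_mulVec,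
    RCLike.ofReal_le_ofReal]
  refine Finset.sum_le_sum fun l _ => ?_
  by_cases hl : (F *ᵥ y) l = 0
  · simp [hl]
  · exact mul_le_mul_of_nonneg_right (h l hl) (sq_nonneg _)

theorem rank_weightedGram {w : ι → ℝ} (hw : ∀ l, 0 < w l) : (weightedGram F w).rank = F.rank := by
  have hdiag : diagonal (fun l => (w l : 𝕜)) =
      (diagonal fun l => (√(w l) : 𝕜))ᴴ * diagonal fun l => (√(w l) : 𝕜) := by
    simp [diagonal_conjTranspose, ← RCLike.ofReal_mul, Real.mul_self_sqrt (hw _).le, Pi.star_def]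
  have hfactor : weightedGram F w =
      ((diagonal fun l => (√(w l) : 𝕜)) * F)ᴴ * ((diagonal fun l => (√(w l) : 𝕜)) * F) := by
    rw [weightedGram, hdiag, conjTranspose_mul]
    simp only [Matrix.mul_assoc]
  rw [hfactor, rank_conjTranspose_mul_self, rank_mul_eq_right_of_isUnit_det]
  simp [det_diagonal, Finset.prod_ne_zero_iff, (Real.sqrt_pos.2 (hw _)).ne']

theorem weightedGram_le_sum_smul_one [DecidableEq n] {w : ι → ℝ} (hw : 0 ≤ w) :
    weightedGram F w ≤ (∑ l, w l * ∑ j, ‖F l j‖ ^ 2) • 1 := by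
  rw [Matrix.le_iff]
  refine .of_dotProduct_mulVec_nonneg
    ((isHermitian_one.smul (.all _)).sub (weightedGram_isHermitian F w)) fun y => ?_
  rw [sub_mulVec, dotProduct_sub, sub_nonneg, smul_mulVec, one_mulVec, dotProduct_smul,
    star_dotProduct_weightedGram_mulVec, star_dotProduct_self_eq_sum,
    RCLike.real_smul_eq_coe_mul, ← RCLike.ofReal_mul, RCLike.ofReal_le_ofReal, Finset.sum_mul]
  refine Finset.sum_le_sum fun l _ => ?_
  rw [mul_assoc]
  exact mul_le_mul_of_nonneg_left (norm_dotProduct_sq_le (F l) y) (hw l)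

end WeightedGram

section Pencils

variable [Fintype p]

theorem exists_ne_zero_mulVec_eq_zero_on {K : Type*} [Field K] {J : Set p} {k : p} (hk : k ∉ J)
    (B : Matrix p p K) :
    ∃ c ≠ 0, (∀ i ∈ J, (B *ᵥ c) i = 0) ∧ ∀ i ∉ J, i ≠ k → c i = 0 := by
  classical
  let L : Matrix p p K :=
    Matrix.of fun i => if i ∈ J then B i else if i = k then 0 else Pi.single i 1
  have hdet : L.det = 0 := det_eq_zero_of_row_eq_zero k fun j => by simp [L, hk]
  obtain ⟨c, hc0, hc⟩ := exists_mulVec_eq_zero_iff.2 hdet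
  refine ⟨c, hc0, fun i hi => ?_, fun i hi hik => ?_⟩
  · simpa [L, mulVec, hi] using congrFun hc i
  · simpa [L, mulVec, hi, hik] using congrFun hc i

theorem commute_diagonal_comp_of_commute_diagonal [DecidableEq p] {P : Matrix p p 𝕜} {θ : p → ℝ}
    (h : Commute P (diagonal fun i => (θ i : 𝕜))) (f : ℝ → ℝ) :
    Commute P (diagonal fun i => (f (θ i) : 𝕜)) := by
  ext i j
  have hij : P i j * θ j = θ i * P i j := by
    simpa only [mul_diagonal, diagonal_mul] using congrFun₂ h.eq i j
  rw [mul_diagonal, diagonal_mul, mul_comm]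
  rcases eq_or_ne (P i j) 0 with hP | hP
  · simp [hP]
  · rw [mul_comm] at hij
    rw [RCLike.ofReal_injective (mul_right_cancel₀ hP hij)]

theorem mul_star_dotProduct_mulVec_le_of_commute_diagonal [DecidableEq p] {P : Matrix p p 𝕜}
    {θ : p → ℝ} (hP : P.PosSemidef) (hcomm : Commute P (diagonal fun i => (θ i : 𝕜)))
    {c : p → 𝕜} {t : ℝ} (hc : ∀ i, c i ≠ 0 → t ≤ θ i) :
    (t : 𝕜) * (star c ⬝ᵥ (P *ᵥ c)) ≤ star c ⬝ᵥ ((P * diagonal fun i => (θ i : 𝕜)) *ᵥ c) := by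
  set Λ : Matrix p p 𝕜 := diagonal fun i => (θ i : 𝕜) with hΛ
  set R : Matrix p p 𝕜 := diagonal fun i => (√(θ i - t) : 𝕜) with hR
  have hRherm : Rᴴ = R :=
    isHermitian_diagonal_of_self_adjoint _ (funext fun i => RCLike.conj_ofReal _)
  have hRP : R * P = P * R :=
    (commute_diagonal_comp_of_commute_diagonal hcomm fun x => √(x - t)).eq.symm
  have hRR : R *ᵥ (R *ᵥ c) = Λ *ᵥ c - (t : 𝕜) • c := by
    ext i
    rcases eq_or_ne (c i) 0 with hi | hi
    · simp [hR, hΛ, mulVec_diagonal, hi]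
    · have hsqrt := Real.mul_self_sqrt (sub_nonneg.2 (hc i hi))
      simp only [hR, hΛ, mulVec_diagonal, Pi.sub_apply, Pi.smul_apply, smul_eq_mul, ← mul_assoc,
        ← RCLike.ofReal_mul, hsqrt]
      push_cast
      ring
  have hform : star (R *ᵥ c) ⬝ᵥ (P *ᵥ (R *ᵥ c)) =
      star c ⬝ᵥ ((P * Λ) *ᵥ c) - t * (star c ⬝ᵥ (P *ᵥ c)) := by
    rw [star_mulVec_dotProduct_mulVec, hRherm, hRP, ← mulVec_mulVec, ← mulVec_mulVec, hRR,
      mulVec_sub, dotProduct_sub, mulVec_mulVec, mulVec_smul, dotProduct_smul, smul_eq_mul]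
  rw [← sub_nonneg, ← hform]
  exact hP.dotProduct_mulVec_nonneg _

theorem mul_star_dotProduct_mulVec_le_of_mul_eq_mul_diagonal [DecidableEq p] {A D Φ : Matrix p p 𝕜}
    {θ : p → ℝ} (hA : A.IsHermitian) (hD : D.PosSemidef)
    (h : A * Φ = D * Φ * diagonal fun i => (θ i : 𝕜))
    {c : p → 𝕜} {t : ℝ} (hc : ∀ i, c i ≠ 0 → t ≤ θ i) :
    (t : 𝕜) * (star (Φ *ᵥ c) ⬝ᵥ (D *ᵥ (Φ *ᵥ c))) ≤ star (Φ *ᵥ c) ⬝ᵥ (A *ᵥ (Φ *ᵥ c)) := by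
  have hP : (Φᴴ * D * Φ).PosSemidef := hD.conjTranspose_mul_mul_same Φ
  have hPΛ : Φᴴ * A * Φ = Φᴴ * D * Φ * diagonal fun i => (θ i : 𝕜) := by
    simp only [Matrix.mul_assoc, h]
  have hΛ : (diagonal fun i => (θ i : 𝕜)).IsHermitian :=
    isHermitian_diagonal_of_self_adjoint _ (funext fun i => RCLike.conj_ofReal (θ i))
  have hcomm := (hP.1.commute_iff hΛ).2 (hPΛ ▸ isHermitian_conjTranspose_mul_mul Φ hA)
  rw [star_mulVec_dotProduct_mulVec, star_mulVec_dotProduct_mulVec, hPΛ]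
  exact mul_star_dotProduct_mulVec_le_of_commute_diagonal hP hcomm hc

variable [Fintype n]

/-- `θ` are the Ritz values of `H` relative to `V` on a trial space where `V` is at least `μ`: the
columns of `X` are a basis of the trial space, and those of `Φ` are a basis of eigenvectors of the
compressed pencil `(Xᴴ H X, Xᴴ V X)` for the generalized eigenvalues `θ`. -/
def IsRitzValues [DecidableEq p] (H V : Matrix n n 𝕜) (μ : ℝ) (θ : p → ℝ) : Prop :=
  ∃ (X : Matrix n p 𝕜) (Φ : Matrix p p 𝕜), Function.Injective X.mulVec ∧
    μ • (Xᴴ * X) ≤ Xᴴ * V * X ∧ IsUnit Φ ∧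
    Xᴴ * H * X * Φ = Xᴴ * V * X * Φ * diagonal fun i => (θ i : 𝕜)

namespace IsRitzValues

variable [DecidableEq p] {H V : Matrix n n 𝕜} {μ : ℝ} {θ : p → ℝ}

theorem neg (h : IsRitzValues H V μ θ) : IsRitzValues (-H) V μ (-θ) := by
  obtain ⟨X, Φ, hX, hV, hΦ, hpencil⟩ := h
  refine ⟨X, Φ, hX, hV, hΦ, ?_⟩
  have hneg : (diagonal fun i => ((-θ) i : 𝕜)) = -diagonal fun i => (θ i : 𝕜) := by
    simp only [Pi.neg_apply, RCLike.ofReal_neg, diagonal_neg]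
  rw [hneg, Matrix.mul_neg, Matrix.mul_neg, Matrix.neg_mul, Matrix.neg_mul, hpencil]

theorem exists_trial_vector (h : IsRitzValues H V μ θ) (hH : H.IsHermitian) (hμ : 0 ≤ μ) {k : p}
    {J : Set p} (hk : k ∉ J) (hJ : ∀ j ∈ J, θ k ≤ θ j) (G : Matrix p n 𝕜) :
    ∃ y ≠ 0, (∀ i ∈ J, (G *ᵥ y) i = 0) ∧
      (θ k : 𝕜) * (star y ⬝ᵥ (V *ᵥ y)) ≤ star y ⬝ᵥ (H *ᵥ y) ∧
      (μ : 𝕜) * (star y ⬝ᵥ y) ≤ star y ⬝ᵥ (V *ᵥ y) := by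
  obtain ⟨X, Φ, hX, hV, hΦ, hpencil⟩ := h
  obtain ⟨c, hc0, hGc, hc⟩ := exists_ne_zero_mulVec_eq_zero_on hk (G * X * Φ)
  have hVpos : (Xᴴ * V * X).PosSemidef := Matrix.nonneg_iff_posSemidef.1 <|
    (smul_nonneg hμ (posSemidef_conjTranspose_mul_self X).nonneg).trans hV
  refine ⟨X *ᵥ (Φ *ᵥ c), ?_, ?_, ?_, ?_⟩
  · intro hy
    have := hX (hy.trans (mulVec_zero X).symm)
    exact hc0 (mulVec_injective_of_isUnit hΦ (this.trans (mulVec_zero Φ).symm))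
  · simpa only [mulVec_mulVec, Matrix.mul_assoc] using hGc
  · rw [star_mulVec_dotProduct_mulVec X, star_mulVec_dotProduct_mulVec X]
    refine mul_star_dotProduct_mulVec_le_of_mul_eq_mul_diagonal
      (isHermitian_conjTranspose_mul_mul X hH) hVpos hpencil fun i hi => ?_
    by_cases hik : i = k
    · rw [hik]
    · exact hJ i (by_contra fun hiJ => hi (hc i hiJ hik))
  · have := star_dotProduct_mulVec_le_of_le hV (Φ *ᵥ c)
    rw [smul_mulVec, dotProduct_smul, RCLike.real_smul_eq_coe_mul] at this
    rw [star_mulVec_dotProduct_mulVec]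
    rwa [star_mulVec, ← dotProduct_mulVec, mulVec_mulVec]

variable [Fintype ι] [DecidableEq ι] {F : Matrix ι n 𝕜} {ω c : ι → ℝ}

theorem neg_weightedGram (h : IsRitzValues (weightedGram F (ω * c)) (weightedGram F c) μ θ) :
    IsRitzValues (weightedGram F (-ω * c)) (weightedGram F c) μ (-θ) := by
  rw [neg_mul, weightedGram_neg]
  exact h.neg

theorem sub_mul_le [DecidableEq n]
    (h : IsRitzValues (weightedGram F (ω * c)) (weightedGram F c) μ θ) (hc : 0 ≤ c)
    (hμ : 0 ≤ μ) {e : p → ι} (hθ : Monovary θ (ω ∘ e)) {k : p} {R : ℝ} (hR0 : 0 ≤ R)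
    (hR : weightedGram F ((Set.range e)ᶜ.indicator fun l => (ω l - ω (e k)) * c l) ≤ R • 1) :
    (θ k - ω (e k)) * μ ≤ R := by
  obtain ⟨y, hy0, hyJ, hyH, hyV⟩ := h.exists_trial_vector (weightedGram_isHermitian F _) hμ
    (J := {i | ω (e k) < ω (e i)}) (lt_irrefl (ω (e k))) (fun i hi => hθ hi) (F.submatrix e id)
  have hband : ∀ l, (F *ᵥ y) l ≠ 0 → (ω l - ω (e k)) * c l ≤
      (Set.range e)ᶜ.indicator (fun l => (ω l - ω (e k)) * c l) l := fun l hl => by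
    by_cases hle : l ∈ Set.range e
    · rw [Set.indicator_of_notMem (Set.notMem_compl_iff.2 hle)]
      obtain ⟨i, rfl⟩ := hle
      have hi : ω (e i) ≤ ω (e k) := le_of_not_gt fun hi => hl (hyJ i hi)
      exact mul_nonpos_of_nonpos_of_nonneg (sub_nonpos.2 hi) (hc _)
    · rw [Set.indicator_of_mem (Set.mem_compl hle)]
  have hyR := (star_dotProduct_weightedGram_mulVec_le F hband).trans
    (star_dotProduct_mulVec_le_of_le hR y)
  have hy : 0 < star y ⬝ᵥ y := dotProduct_star_self_pos_iff.2 hy0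
  simp only [smul_mulVec, one_mulVec, dotProduct_smul, RCLike.real_smul_eq_coe_mul,
    star_dotProduct_weightedGram_mulVec, star_dotProduct_self_eq_sum, ← RCLike.ofReal_mul,
    RCLike.ofReal_le_ofReal, RCLike.ofReal_pos] at hyH hyV hyR hy
  set s := ∑ i, ‖y i‖ ^ 2
  set q := ∑ l, c l * ‖(F *ᵥ y) l‖ ^ 2 with hq
  have hRs : (θ k - ω (e k)) * q ≤ R * s :=
    calc (θ k - ω (e k)) * q ≤ ∑ l, (ω * c) l * ‖(F *ᵥ y) l‖ ^ 2 - ω (e k) * q := by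
          rw [sub_mul]
          exact sub_le_sub_right hyH _
      _ = ∑ l, (ω l - ω (e k)) * c l * ‖(F *ᵥ y) l‖ ^ 2 := by
          rw [hq, Finset.mul_sum, ← Finset.sum_sub_distrib]
          refine Finset.sum_congr rfl fun l _ => ?_
          rw [Pi.mul_apply]
          ring
      _ ≤ R * s := hyR
  rcases le_total (θ k - ω (e k)) 0 with hle | hge
  · exact (mul_nonpos_of_nonpos_of_nonneg hle hμ).trans hR0
  · refine le_of_mul_le_mul_right ?_ hy
    rw [mul_assoc]
    exact (mul_le_mul_of_nonneg_left hyV hge).trans hRs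

theorem sub_le_div_mul [DecidableEq n]
    (h : IsRitzValues (weightedGram F (ω * c)) (weightedGram F c) μ θ)
    (hc : 0 ≤ c) (hμ : 0 < μ) {e : p → ι} (hθ : Monovary θ (ω ∘ e)) {Λ : ℝ} (hΛ0 : 0 ≤ Λ)
    (hΛ : weightedGram F ((Set.range e)ᶜ.indicator c) ≤ Λ • 1) {k : p} {d : ℝ}
    (hd : ∀ l, ω l - ω (e k) ≤ d) : θ k - ω (e k) ≤ Λ / μ * d := by
  have hd0 : 0 ≤ d := by simpa using hd (e k)
  rw [div_mul_eq_mul_div, le_div_iff₀ hμ, mul_comm Λ]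
  refine h.sub_mul_le hc hμ.le hθ (mul_nonneg hd0 hΛ0) ?_
  calc weightedGram F ((Set.range e)ᶜ.indicator fun l => (ω l - ω (e k)) * c l)
      ≤ weightedGram F (d • (Set.range e)ᶜ.indicator c) := by
        refine weightedGram_mono F fun l => ?_
        rw [Pi.smul_apply, smul_eq_mul]
        by_cases hl : l ∈ (Set.range e)ᶜ
        · simpa only [Set.indicator_of_mem hl] using mul_le_mul_of_nonneg_right (hd l) (hc l)
        · simp only [Set.indicator_of_notMem hl, mul_zero, le_refl]
    _ ≤ d • (Λ • 1) := by
        rw [weightedGram_smul]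
        exact smul_le_smul_of_nonneg_left hΛ hd0
    _ = (d * Λ) • 1 := smul_smul d Λ 1

theorem div_mul_le_sub [DecidableEq n]
    (h : IsRitzValues (weightedGram F (ω * c)) (weightedGram F c) μ θ)
    (hc : 0 ≤ c) (hμ : 0 < μ) {e : p → ι} (hθ : Monovary θ (ω ∘ e)) {Λ : ℝ} (hΛ0 : 0 ≤ Λ)
    (hΛ : weightedGram F ((Set.range e)ᶜ.indicator c) ≤ Λ • 1) {k : p} {d : ℝ}
    (hd : ∀ l, d ≤ ω l - ω (e k)) : Λ / μ * d ≤ θ k - ω (e k) := by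
  have := h.neg_weightedGram.sub_le_div_mul hc hμ
    (fun i j hij => neg_le_neg (hθ (neg_lt_neg_iff.1 hij))) hΛ0 hΛ (k := k) (d := -d)
    fun l => by simp only [Pi.neg_apply]; linarith [hd l]
  simp only [Pi.neg_apply] at this
  linarith

theorem sub_le_sum_div (h : IsRitzValues (weightedGram F (ω * c)) (weightedGram F c) μ θ)
    (hc : 0 ≤ c) (hμ : 0 < μ) {e : p → ι} (hθ : Monovary θ (ω ∘ e)) {k : p} {K : Finset ι}
    (hK : ∀ l ∈ K, ω (e k) ≤ ω l) (hKc : ∀ l ∉ K, l ∈ Set.range e ∨ ω l ≤ ω (e k)) :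
    θ k - ω (e k) ≤ (∑ l ∈ K, (ω l - ω (e k)) * c l * ∑ j, ‖F l j‖ ^ 2) / μ := by
  classical
  let w : ι → ℝ := (K : Set ι).indicator fun l => (ω l - ω (e k)) * c l
  have hw : 0 ≤ w := Set.indicator_nonneg fun l hl => mul_nonneg (sub_nonneg.2 (hK l hl)) (hc l)
  have hsum : ∑ l ∈ K, (ω l - ω (e k)) * c l * ∑ j, ‖F l j‖ ^ 2 = ∑ l, w l * ∑ j, ‖F l j‖ ^ 2 := by
    simp only [w, Set.indicator_apply, Finset.mem_coe, ite_mul, zero_mul, Finset.sum_ite_mem,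
      Finset.univ_inter]
  rw [le_div_iff₀ hμ, hsum]
  refine h.sub_mul_le hc hμ.le hθ
    (Finset.sum_nonneg fun l _ => mul_nonneg (hw l) (by positivity)) ?_
  refine (weightedGram_mono F fun l => ?_).trans (weightedGram_le_sum_smul_one F hw)
  by_cases hl : l ∈ K
  · rw [show w l = _ from Set.indicator_of_mem (Finset.mem_coe.2 hl) _]
    exact Set.indicator_le_self' (fun _ _ => mul_nonneg (sub_nonneg.2 (hK l hl)) (hc l)) l
  · refine Set.indicator_apply_le' (fun hle => ?_) fun _ => hw l
    exact (mul_nonpos_of_nonpos_of_nonneg (sub_nonpos.2 ((hKc l hl).resolve_left hle))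
      (hc l)).trans (hw l)

theorem sum_div_le_sub (h : IsRitzValues (weightedGram F (ω * c)) (weightedGram F c) μ θ)
    (hc : 0 ≤ c) (hμ : 0 < μ) {e : p → ι} (hθ : Monovary θ (ω ∘ e)) {k : p} {K : Finset ι}
    (hK : ∀ l ∈ K, ω l ≤ ω (e k)) (hKc : ∀ l ∉ K, l ∈ Set.range e ∨ ω (e k) ≤ ω l) :
    (∑ l ∈ K, (ω l - ω (e k)) * c l * ∑ j, ‖F l j‖ ^ 2) / μ ≤ θ k - ω (e k) := by
  have := h.neg_weightedGram.sub_le_sum_div hc hμ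
    (fun i j hij => neg_le_neg (hθ (neg_lt_neg_iff.1 hij))) (k := k) (K := K)
    (fun l hl => neg_le_neg (hK l hl)) fun l hl => (hKc l hl).imp_right neg_le_neg
  simp only [Pi.neg_apply, neg_sub_neg, ← neg_sub (ω _) (ω (e k)), neg_mul,
    Finset.sum_neg_distrib, neg_div] at this
  linarith

end IsRitzValues

end Pencils

section DescendingEigenvalues

variable {M : ℕ} {A : Matrix (Fin M) (Fin M) ℂ}

theorem le_eigenvalueDesc_one_smul_one (hA : A.IsHermitian) : A ≤ eigenvalueDesc hA 1 • 1 :=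
  le_smul_one_of_eigenvalues_le hA fun i => by
    rw [eigenvalueDesc, dif_pos ⟨le_rfl, Nat.one_le_of_lt i.2⟩]
    exact hA.eigenvalues₀_antitone (Fin.mk_le_of_le_val (Nat.zero_le _))

theorem eigenvalueDesc_nonneg (hA : A.PosSemidef) (j : ℕ) : 0 ≤ eigenvalueDesc hA.1 j := by
  unfold eigenvalueDesc
  split_ifs with h
  · simpa [IsHermitian.eigenvalues] using
      hA.eigenvalues_nonneg (Fintype.equivOfCardEq (Fintype.card_fin _) ⟨j - 1, _⟩)
  · exact le_rfl

theorem eigenvalueDesc_pos_of_le_rank (hA : A.PosSemidef) {j : ℕ} (hj : j ≠ 0)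
    (hjA : j ≤ A.rank) : 0 < eigenvalueDesc hA.1 j := by
  rw [eigenvalueDesc, dif_pos ⟨Nat.one_le_iff_ne_zero.2 hj, hjA.trans A.rank_le_width⟩]
  exact eigenvalues₀_pos_of_lt_rank hA (by simp only; omega)

theorem eigenvalueDesc_eq_of_charpoly_eq (hA : A.IsHermitian) {lam : Fin M → ℝ}
    (hlam : Antitone lam) (h : A.charpoly = (diagonal fun i => (lam i : ℂ)).charpoly) (i : Fin M) :
    eigenvalueDesc hA (i + 1) = lam i := by
  have hroots : A.charpoly.roots = Multiset.map (fun i => (lam i : ℂ)) Finset.univ.val := by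
    rw [h, charpoly_diagonal, Polynomial.roots_prod]
    · simp
    · simp [Finset.prod_ne_zero_iff, Polynomial.X_sub_C_ne_zero]
  have hsort : (A.charpoly.roots.map RCLike.re).sort (· ≥ ·) = List.ofFn lam := by
    simp_rw [hroots, Fin.univ_val_map, Multiset.map_coe, List.map_ofFn, Function.comp_def,
      RCLike.re_eq_complex_re, Complex.ofReal_re, Multiset.coe_sort]
    apply List.mergeSort_of_pairwise
    simp_rw [decide_eq_true_eq, ← List.sortedGE_iff_pairwise]
    exact hlam.sortedGE_ofFn
  have hget := congrArg (fun l => l[(i : ℕ)]?) hA.sort_roots_charpoly_eq_eigenvalues₀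
  simp only [hsort, List.getElem?_ofFn] at hget
  rw [eigenvalueDesc, dif_pos ⟨by omega, by omega⟩]
  simpa using hget.symm

theorem IsOutput.isRitzValues {m : ℕ} {hmM : m ≤ M} {H V : Matrix (Fin M) (Fin M) ℂ}
    {ωt : Fin m → ℝ} (h : IsOutput hmM H V ωt) (hV : V.IsHermitian) :
    IsRitzValues H V (eigenvalueDesc hV m) ωt := by
  obtain ⟨-, U, hU, lam, hlam, hdiag, Φ, hΦ, hpencil⟩ := h
  set X : Matrix (Fin M) (Fin m) ℂ := U.submatrix id (Fin.castLE hmM) with hX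
  have hcompress : ∀ B : Matrix (Fin M) (Fin M) ℂ,
      Xᴴ * B * X = (Uᴴ * B * U).submatrix (Fin.castLE hmM) (Fin.castLE hmM) := fun B => by
    ext i j
    simp [hX, mul_apply]
  have hXX : Xᴴ * X = 1 := by
    have hUU : Uᴴ * U = 1 := mem_unitaryGroup_iff'.1 hU
    simpa [hUU, submatrix_one _ (Fin.castLE_injective hmM)] using hcompress 1
  have hXVX : Xᴴ * V * X = diagonal fun i => (lam (Fin.castLE hmM i) : ℂ) := by
    rw [hcompress, hdiag, submatrix_diagonal _ _ (Fin.castLE_injective hmM)]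
    rfl
  have hcharpoly : V.charpoly = (diagonal fun i => (lam i : ℂ)).charpoly := by
    have hUU : U * Uᴴ = 1 := mem_unitaryGroup_iff.1 hU
    rw [← hdiag, charpoly_mul_comm, ← Matrix.mul_assoc, hUU, Matrix.one_mul]
  have hlast : ∀ i : Fin m, eigenvalueDesc hV m ≤ lam (Fin.castLE hmM i) := fun i => by
    have heq := eigenvalueDesc_eq_of_charpoly_eq hV hlam hcharpoly ⟨m - 1, by have := i.2; omega⟩
    rw [Nat.sub_add_cancel (Nat.one_le_of_lt i.2)] at heq
    rw [heq]
    exact hlam (Fin.le_def.2 (Nat.le_sub_one_of_lt i.2))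
  refine ⟨X, Φ, fun x y hxy => ?_, ?_, hΦ, hpencil⟩
  · simpa [hXX] using congrArg (Xᴴ *ᵥ ·) hxy
  · rw [hXX, hXVX, Matrix.le_iff, ← diagonal_one, ← diagonal_smul, diagonal_sub,
      posSemidef_diagonal_iff]
    intro i
    simpa using hlast i

end DescendingEigenvalues

section Signals

variable {T W : ℝ}

theorem FilterSystem.F_eq_intervalIntegral (Fs : FilterSystem T W) (hT : 0 ≤ T) (l : ℕ) (ω : ℝ) :
    Fs.F l ω = ∫ t in (-T)..T, Fs.f l t * Complex.exp (-Complex.I * (ω : ℂ) * (t : ℂ)) := by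
  rw [intervalIntegral.integral_of_le (neg_le_self hT), ← integral_Icc_eq_integral_Ioc,
    setIntegral_eq_integral_of_ae_compl_eq_zero]
  · rfl
  · filter_upwards [Fs.support l] with t ht h
    rw [ht h, zero_mul]

theorem Signal.deriv_C_sub (S : Signal) (τ t : ℝ) :
    deriv (fun t' : ℝ => S.C (τ - t')) t =
      ∑ k, (-Complex.I * ((S.freq k * ‖S.amp k‖ ^ 2 : ℝ) : ℂ)) *
        Complex.exp (Complex.I * (S.freq k : ℂ) * ((τ - t : ℝ) : ℂ)) := by
  have hsub : HasDerivAt (fun t' : ℝ => ((τ - t' : ℝ) : ℂ)) (-1) t := by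
    simpa using ((hasDerivAt_id t).const_sub τ).ofReal_comp
  refine HasDerivAt.deriv (HasDerivAt.fun_sum fun k _ => ?_)
  refine (((hsub.const_mul (Complex.I * (S.freq k : ℂ))).cexp).const_mul
    ((‖S.amp k‖ ^ 2 : ℝ) : ℂ)).congr_deriv ?_
  push_cast
  ring

/-- The weights `|aₖ|²` of the frequencies of a signal. -/
noncomputable def Signal.weight (S : Signal) (k : Fin S.N) : ℝ := ‖S.amp k‖ ^ 2

theorem Signal.weight_pos (S : Signal) (k : Fin S.N) : 0 < S.weight k :=
  pow_pos (norm_pos_iff.2 (S.amp_ne_zero k)) 2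

theorem Signal.weight_nonneg (S : Signal) : 0 ≤ S.weight := fun k => (S.weight_pos k).le

/-- The values of the first `M` filter functions at the frequencies of the signal, one row for each
frequency. -/
noncomputable def filterMatrix (S : Signal) (Fs : FilterSystem T W) (ωc : ℝ) (M : ℕ) :
    Matrix (Fin S.N) (Fin M) ℂ :=
  Matrix.of fun k l => Fs.F l (S.freq k - ωc)

variable (S : Signal) (Fs : FilterSystem T W) (ωc : ℝ) (M : ℕ)

theorem gramMatrix_eq_weightedGram (hT : 0 ≤ T) :
    gramMatrix S Fs ωc M = weightedGram (filterMatrix S Fs ωc M) S.weight := by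
  ext s l
  simp only [gramMatrix, Matrix.of_apply, Signal.C, weightedGram_apply, filterMatrix]
  rw [integral_gram _ _ (Fs.intervalIntegrable _) (Fs.intervalIntegrable _)]
  simp only [Fs.F_eq_intervalIntegral hT]
  rfl

theorem hamiltonianMatrix_eq_weightedGram (hT : 0 ≤ T) :
    hamiltonianMatrix S Fs ωc M = weightedGram (filterMatrix S Fs ωc M) (S.freq * S.weight) := by
  ext s l
  simp only [hamiltonianMatrix, Matrix.of_apply, Signal.deriv_C_sub, weightedGram_apply,
    filterMatrix]
  rw [integral_gram _ _ (Fs.intervalIntegrable _) (Fs.intervalIntegrable _), Finset.mul_sum]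
  simp only [← Fs.F_eq_intervalIntegral hT]
  refine Finset.sum_congr rfl fun k _ => ?_
  simp only [Pi.mul_apply, Signal.weight, ← mul_assoc, mul_neg, Complex.I_mul_I, neg_neg, one_mul]
  rfl

theorem noiseGramMatrix_eq_weightedGram :
    noiseGramMatrix S Fs ωc M = weightedGram (filterMatrix S Fs ωc M)
      ({k | S.freq k ∈ band W ωc}ᶜ.indicator S.weight) := by
  ext s l
  simp only [noiseGramMatrix, weightedGram_apply, filterMatrix, Matrix.of_apply, Finset.sum_filter]
  refine Finset.sum_congr rfl fun k _ => ?_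
  by_cases hk : S.freq k ∈ band W ωc <;> simp [hk, Signal.weight]

theorem noiseGramMatrix_posSemidef : (noiseGramMatrix S Fs ωc M).PosSemidef := by
  rw [noiseGramMatrix_eq_weightedGram]
  exact weightedGram_posSemidef _ (Set.indicator_nonneg fun k _ => S.weight_nonneg k)

theorem noiseEigenvalue_nonneg (j : ℕ) : 0 ≤ noiseEigenvalue S Fs ωc M j :=
  eigenvalueDesc_nonneg (noiseGramMatrix_posSemidef S Fs ωc M) j

theorem weightedGram_compl_band_le_smul_one :
    weightedGram (filterMatrix S Fs ωc M) ({k | S.freq k ∈ band W ωc}ᶜ.indicator S.weight) ≤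
      noiseEigenvalue S Fs ωc M 1 • 1 := by
  rw [← noiseGramMatrix_eq_weightedGram]
  exact le_eigenvalueDesc_one_smul_one (noiseGramMatrix_isHermitian S Fs ωc M)

variable {S Fs ωc M} {m : ℕ}

theorem IsBandFrequencies.exists_index {ν : Fin m → ℝ} (hν : IsBandFrequencies S W ωc ν) :
    ∃ e : Fin m → Fin S.N, S.freq ∘ e = ν ∧ Set.range e = {k | S.freq k ∈ band W ωc} := by
  have hmem : ∀ i, ν i ∈ Set.range S.freq ∩ band W ωc := fun i => hν.2 ▸ Set.mem_range_self i
  choose e he using fun i => (hmem i).1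
  refine ⟨e, funext he, Set.ext fun k => ⟨?_, fun hk => ?_⟩⟩
  · rintro ⟨i, rfl⟩
    exact (congrArg (· ∈ band W ωc) (he i)).mpr (hmem i).2
  · obtain ⟨i, hi⟩ : S.freq k ∈ Set.range ν := hν.2 ▸ ⟨Set.mem_range_self k, hk⟩
    exact ⟨i, S.freq_injective ((he i).trans hi)⟩

theorem IsBandFrequencies.mem_band {ν : Fin m → ℝ} (hν : IsBandFrequencies S W ωc ν) (i : Fin m) :
    ν i ∈ band W ωc :=
  (hν.2 ▸ Set.mem_range_self i : ν i ∈ Set.range S.freq ∩ band W ωc).2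

theorem IsBandFrequencies.le_rank_filterMatrix {ν : Fin m → ℝ} (hν : IsBandFrequencies S W ωc ν)
    (hmM : m ≤ M) : m ≤ (filterMatrix S Fs ωc M).rank := by
  obtain ⟨e, rfl, -⟩ := hν.exists_index
  have hdet : ((filterMatrix S Fs ωc M).submatrix e (Fin.castLE hmM)).det ≠ 0 :=
    Fs.chebyshev m (fun i => S.freq (e i) - ωc)
      (fun i j hij => hν.1.injective (sub_left_injective hij))
      fun i => by
        have : S.freq (e i) ∈ band W ωc := hν.mem_band i
        exact ⟨by linarith [this.1], by linarith [this.2]⟩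
  calc m = ((filterMatrix S Fs ωc M).submatrix e (Fin.castLE hmM)).rank := by
        rw [rank_of_det_ne_zero hdet, Fintype.card_fin]
    _ ≤ (filterMatrix S Fs ωc M).rank := rank_submatrix_le _ _ _

theorem gramMatrix_posSemidef (hT : 0 ≤ T) : (gramMatrix S Fs ωc M).PosSemidef := by
  rw [gramMatrix_eq_weightedGram S Fs ωc M hT]
  exact weightedGram_posSemidef _ S.weight_nonneg

theorem gramEigenvalue_pos (hT : 0 ≤ T) {ν : Fin m → ℝ} (hν : IsBandFrequencies S W ωc ν)
    (hmM : m ≤ M) (hm : m ≠ 0) : 0 < gramEigenvalue S Fs ωc M m := by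
  refine eigenvalueDesc_pos_of_le_rank (gramMatrix_posSemidef hT) hm ?_
  rw [gramMatrix_eq_weightedGram S Fs ωc M hT, rank_weightedGram _ S.weight_pos]
  exact hν.le_rank_filterMatrix hmM

theorem IsOutput.isRitzValues_weightedGram (hT : 0 ≤ T) {hmM : m ≤ M} {ωt : Fin m → ℝ}
    (h : IsOutput hmM (hamiltonianMatrix S Fs ωc M) (gramMatrix S Fs ωc M) ωt) :
    IsRitzValues (weightedGram (filterMatrix S Fs ωc M) (S.freq * S.weight))
      (weightedGram (filterMatrix S Fs ωc M) S.weight) (gramEigenvalue S Fs ωc M m) ωt := by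
  rw [← hamiltonianMatrix_eq_weightedGram S Fs ωc M hT, ← gramMatrix_eq_weightedGram S Fs ωc M hT]
  exact h.isRitzValues (gramMatrix_isHermitian S Fs ωc M)

theorem FilterSystem.envelope_nonneg (ω : ℝ) : 0 ≤ Fs.envelope M ω :=
  Finset.sum_nonneg fun _ _ => sq_nonneg _

theorem gramEigenvalue_sub_noiseEigenvalue_pos
    (hgap : (m + 1) * noiseEigenvalue S Fs ωc M 1 < gramEigenvalue S Fs ωc M m) :
    0 < gramEigenvalue S Fs ωc M m - noiseEigenvalue S Fs ωc M 1 := by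
  have : 0 ≤ m * noiseEigenvalue S Fs ωc M 1 :=
    mul_nonneg m.cast_nonneg (noiseEigenvalue_nonneg S Fs ωc M 1)
  linarith

theorem sum_above_div_le_div_sub {x : ℝ} (hx : x ∈ band W ωc)
    (hgap : (m + 1) * noiseEigenvalue S Fs ωc M 1 < gramEigenvalue S Fs ωc M m) :
    (∑ l with ωc + W < S.freq l,
        (S.freq l - x) * ‖S.amp l‖ ^ 2 * Fs.envelope M (S.freq l - ωc)) /
        gramEigenvalue S Fs ωc M m ≤
      (∑ l with ωc + W < S.freq l,
        (S.freq l - x) * ‖S.amp l‖ ^ 2 * Fs.envelope M (S.freq l - ωc)) /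
        (gramEigenvalue S Fs ωc M m - noiseEigenvalue S Fs ωc M 1) := by
  refine div_le_div_of_nonneg_left (Finset.sum_nonneg fun l hl => ?_)
    (gramEigenvalue_sub_noiseEigenvalue_pos hgap)
    (sub_le_self _ (noiseEigenvalue_nonneg S Fs ωc M 1))
  have hl : ωc + W < S.freq l := (Finset.mem_filter.1 hl).2
  exact mul_nonneg (mul_nonneg (sub_nonneg.2 (hx.2.trans hl.le)) (sq_nonneg _))
    (Fs.envelope_nonneg _)

theorem sum_below_div_sub_le_div {x : ℝ} (hx : x ∈ band W ωc)
    (hgap : (m + 1) * noiseEigenvalue S Fs ωc M 1 < gramEigenvalue S Fs ωc M m) :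
    (∑ l with S.freq l < ωc - W,
        (S.freq l - x) * ‖S.amp l‖ ^ 2 * Fs.envelope M (S.freq l - ωc)) /
        (gramEigenvalue S Fs ωc M m - noiseEigenvalue S Fs ωc M 1) ≤
      (∑ l with S.freq l < ωc - W,
        (S.freq l - x) * ‖S.amp l‖ ^ 2 * Fs.envelope M (S.freq l - ωc)) /
        gramEigenvalue S Fs ωc M m := by
  have hpos := gramEigenvalue_sub_noiseEigenvalue_pos hgap
  have hinv := inv_anti₀ hpos (sub_le_self _ (noiseEigenvalue_nonneg S Fs ωc M 1))
  rw [div_eq_mul_inv, div_eq_mul_inv]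
  refine mul_le_mul_of_nonpos_left hinv (Finset.sum_nonpos fun l hl => ?_)
  have hl : S.freq l < ωc - W := (Finset.mem_filter.1 hl).2
  exact mul_nonpos_of_nonpos_of_nonneg
    (mul_nonpos_of_nonpos_of_nonneg (sub_nonpos.2 (hl.le.trans hx.1)) (sq_nonneg _))
    (Fs.envelope_nonneg _)

end Signals

end FilterDiag

theorem mainTheorem10_general (S : FilterDiag.Signal) (T W : ℝ) (hT : 0 ≤ T)
    (Fs : FilterDiag.FilterSystem T W) (ωc : ℝ)
    (m : ℕ) (ν : Fin m → ℝ) (hν : FilterDiag.IsBandFrequencies S W ωc ν)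
    (M : ℕ) (hmM : m ≤ M) (ωt : Fin m → ℝ)
    (hωt : FilterDiag.IsOutput hmM (FilterDiag.hamiltonianMatrix S Fs ωc M)
      (FilterDiag.gramMatrix S Fs ωc M) ωt) :
    (∀ ωmin ωmax : ℝ, (∀ l, S.freq l ∈ Set.Icc ωmin ωmax) → ∀ k : Fin m,
      FilterDiag.noiseEigenvalue S Fs ωc M 1 / FilterDiag.gramEigenvalue S Fs ωc M m *
          (ωmin - ν k) ≤ ωt k - ν k ∧
      ωt k - ν k ≤
        FilterDiag.noiseEigenvalue S Fs ωc M 1 / FilterDiag.gramEigenvalue S Fs ωc M m *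
          (ωmax - ν k)) ∧
    ∀ k : Fin m,
      (∑ l with S.freq l < ωc - W,
          (S.freq l - ν k) * ‖S.amp l‖ ^ 2 * Fs.envelope M (S.freq l - ωc)) /
          FilterDiag.gramEigenvalue S Fs ωc M m ≤ ωt k - ν k ∧
      ωt k - ν k ≤
        (∑ l with ωc + W < S.freq l,
          (S.freq l - ν k) * ‖S.amp l‖ ^ 2 * Fs.envelope M (S.freq l - ωc)) /
          FilterDiag.gramEigenvalue S Fs ωc M m := by
  obtain ⟨e, rfl, he⟩ := hν.exists_index
  have hRitz := hωt.isRitzValues_weightedGram hT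
  have hθ : Monovary ωt (S.freq ∘ e) := hωt.1.monovary hν.1.antitone
  have hpos (k : Fin m) : 0 < FilterDiag.gramEigenvalue S Fs ωc M m :=
    FilterDiag.gramEigenvalue_pos hT hν hmM k.pos.ne'
  have hnoise := FilterDiag.noiseEigenvalue_nonneg S Fs ωc M 1
  have hN := FilterDiag.weightedGram_compl_band_le_smul_one S Fs ωc M
  rw [← he] at hN
  refine ⟨fun ωmin ωmax hω k => ⟨?_, ?_⟩, fun k => ⟨?_, ?_⟩⟩
  · exact hRitz.div_mul_le_sub S.weight_nonneg (hpos k) hθ hnoise hN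
      fun l => sub_le_sub_right (hω l).1 _
  · exact hRitz.sub_le_div_mul S.weight_nonneg (hpos k) hθ hnoise hN
      fun l => sub_le_sub_right (hω l).2 _
  · refine hRitz.sum_div_le_sub S.weight_nonneg (hpos k) hθ (fun l hl => ?_) fun l hl => ?_
    · exact (Finset.mem_filter.1 hl).2.le.trans (hν.mem_band k).1
    · rw [he]
      have hl : ωc - W ≤ S.freq l := by simpa using hl
      exact (le_or_gt (S.freq l) (ωc + W)).imp (⟨hl, ·⟩) fun h => (hν.mem_band k).2.trans h.le
  · refine hRitz.sub_le_sum_div S.weight_nonneg (hpos k) hθ (fun l hl => ?_) fun l hl => ?_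
    · exact (hν.mem_band k).2.trans (Finset.mem_filter.1 hl).2.le
    · rw [he]
      have hl : S.freq l ≤ ωc + W := by simpa using hl
      exact (le_or_gt (ωc - W) (S.freq l)).imp (⟨·, hl⟩) fun h => h.le.trans (hν.mem_band k).1

theorem mainTheorem10 (S : FilterDiag.Signal) (T W : ℝ) (hT : 0 < T) (hW : 0 < W)
    (Fs : FilterDiag.FilterSystem T W) (ωc : ℝ)
    (m : ℕ) (ν : Fin m → ℝ) (hν : FilterDiag.IsBandFrequencies S W ωc ν)
    (M : ℕ) (hmM : m ≤ M) (ωt : Fin m → ℝ)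
    (hωt : FilterDiag.IsOutput hmM (FilterDiag.hamiltonianMatrix S Fs ωc M)
      (FilterDiag.gramMatrix S Fs ωc M) ωt) :
    (∀ ωmin ωmax : ℝ, (∀ l, S.freq l ∈ Set.Icc ωmin ωmax) → ∀ k : Fin m,
      FilterDiag.noiseEigenvalue S Fs ωc M 1 / FilterDiag.gramEigenvalue S Fs ωc M m *
          (ωmin - ν k) ≤ ωt k - ν k ∧
      ωt k - ν k ≤
        FilterDiag.noiseEigenvalue S Fs ωc M 1 / FilterDiag.gramEigenvalue S Fs ωc M m *
          (ωmax - ν k)) ∧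
    (FilterDiag.gramEigenvalue S Fs ωc M m >
        ((m : ℝ) + 1) * FilterDiag.noiseEigenvalue S Fs ωc M 1 → ∀ k : Fin m,
      (∑ l with S.freq l < ωc - W,
          (S.freq l - ν k) * ‖S.amp l‖ ^ 2 * Fs.envelope M (S.freq l - ωc)) /
          (FilterDiag.gramEigenvalue S Fs ωc M m - FilterDiag.noiseEigenvalue S Fs ωc M 1)
        ≤ ωt k - ν k ∧
      ωt k - ν k ≤
        (∑ l with ωc + W < S.freq l,
          (S.freq l - ν k) * ‖S.amp l‖ ^ 2 * Fs.envelope M (S.freq l - ωc)) /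
          (FilterDiag.gramEigenvalue S Fs ωc M m - FilterDiag.noiseEigenvalue S Fs ωc M 1)) := by
  obtain ⟨h₁, h₂⟩ := mainTheorem10_general S T W hT.le Fs ωc m ν hν M hmM ωt hωt
  exact ⟨h₁, fun hgap k =>
    ⟨(FilterDiag.sum_below_div_sub_le_div (hν.mem_band k) hgap).trans (h₂ k).1,
      (h₂ k).2.trans (FilterDiag.sum_above_div_le_div_sub (hν.mem_band k) hgap)⟩⟩
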